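/- For a bit string $x\in\{0,1\}^n$ and $0<\delta<1$, let $\mathrm{Del}_\delta(x)$ be the distribution of the trace obtained from $x$ by deleting each bit independently with probability $\delta$ and concatenating the surviving bits in order. Write $|\mathsf{LCS}(u,v)|$ for the length of a longest common (not necessarily contiguous) subsequence of the strings $u$ and $v$, and let $$L_{1,\mathrm{avg}}(\delta,n)=\max_{A}\ \mathbb{E}_{x\sim\{0,1\}^n}\ \mathbb{E}_{y\sim \mathrm{Del}_\delta(x)}\big[\,|\mathsf{LCS}(A(y),x)|\,\big],$$ where $x$ is uniform on $\{0,1\}^n$ and $A$ ranges over all maps (which may depend on $n$ and $\delta$) from bit strings to $\{0,1\}^n$. (Average-case upper bound on any algorithm.) There is an absolute constant $c>0$ such that for every sequence of deletion rates $\delta=\delta(n)\in(0,1)$ with $\delta(n)=\omega(1/n)$, we have $$L_{1,\mathrm{avg}}(\delta(n),n)\le (1-c\,\delta(n))\,n$$ for all sufficiently large $n$ (how large may depend on the sequence $\delta$). Up to the value of $c$ this is best possible: for every $n\ge 0$ and every $0<\delta<1$, $L_{1,\mathrm{avg}}(\delta,n)\ge(1-\delta)n$. -/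

import Mathlib

namespace OneTrace

/-- `|LCS(u, v)|`: the length of a longest common subsequence of two bit strings. Subsequences
need not be contiguous (`List.Sublist`). -/
noncomputable def lcsLength (u v : List Bool) : ℕ :=
  sSup {k : ℕ | ∃ w : List Bool, w.Sublist u ∧ w.Sublist v ∧ w.length = k}

/-- The length of a longest common subsequence is attained, and is the largest such length. -/
theorem lcsLength_isGreatest (u v : List Bool) :
    IsGreatest {k : ℕ | ∃ w : List Bool, w.Sublist u ∧ w.Sublist v ∧ w.length = k}
      (lcsLength u v) := by
  have hb : BddAbove {k : ℕ | ∃ w : List Bool, w.Sublist u ∧ w.Sublist v ∧ w.length = k} := by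
    refine ⟨u.length, ?_⟩
    rintro k ⟨w, hu, -, rfl⟩
    exact hu.length_le
  have hne : {k : ℕ | ∃ w : List Bool, w.Sublist u ∧ w.Sublist v ∧ w.length = k}.Nonempty :=
    ⟨0, [], List.nil_sublist u, List.nil_sublist v, rfl⟩
  exact ⟨Nat.sSup_mem hne hb, fun k hk => le_csSup hb hk⟩

/-- The trace of the source string `x` when the set of deleted locations is `D`: the bits of `x`
at the locations outside `D`, concatenated from left to right. -/
def trace {n : ℕ} (x : Fin n → Bool) (D : Finset (Fin n)) : List Bool :=
  ((List.finRange n).filter (fun i => i ∉ D)).map x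

/-- The probability that the set of deleted locations is `D`, when each of the `n` locations is
deleted independently with probability `δ`. -/
def deletionProb (δ : ℝ) {n : ℕ} (D : Finset (Fin n)) : ℝ :=
  ∏ i : Fin n, if i ∈ D then δ else 1 - δ

/-- The expectation of `f y` for a trace `y` drawn from the `δ`-deletion channel applied
to `x`. -/
def traceExpectation (δ : ℝ) {n : ℕ} (x : Fin n → Bool) (f : List Bool → ℝ) : ℝ :=
  ∑ D : Finset (Fin n), deletionProb δ D * f (trace x D)

/-- The expected length of a longest common subsequence of `A y` and `x`, where `x` is a uniformly
random `n`-bit string and `y` is a single trace of `x` at deletion rate `δ`. -/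
noncomputable def avgPerformance (δ : ℝ) (n : ℕ) (A : List Bool → (Fin n → Bool)) : ℝ :=
  (∑ x : Fin n → Bool,
    traceExpectation δ x (fun y => (lcsLength (List.ofFn (A y)) (List.ofFn x) : ℝ))) / 2 ^ n

/-- `L_{1,avg}(δ, n)`: the largest expected length of a longest common subsequence achieved by any
one-trace algorithm. An algorithm may depend on `δ` and `n`, which are fixed
here, and maps each trace to an `n`-bit hypothesis string. -/
noncomputable def bestAvgPerformance (δ : ℝ) (n : ℕ) : ℝ :=
  ⨆ A : List Bool → (Fin n → Bool), avgPerformance δ n A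

/-- The supremum in `bestAvgPerformance` is a maximum. -/
theorem bestAvgPerformance_isGreatest (δ : ℝ) (n : ℕ) :
    IsGreatest (Set.range (avgPerformance δ n)) (bestAvgPerformance δ n) := by
  have hfin : (Set.range (avgPerformance δ n)).Finite := by
    let g : ((Fin n → Bool) → Finset (Fin n) → (Fin n → Bool)) → ℝ := fun B =>
      (∑ x : Fin n → Bool, ∑ D : Finset (Fin n),
        deletionProb δ D * (lcsLength (List.ofFn (B x D)) (List.ofFn x) : ℝ)) / 2 ^ n
    refine (Set.finite_range g).subset ?_
    rintro _ ⟨A, rfl⟩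
    exact ⟨fun x D => A (trace x D), rfl⟩
  have hne : (Set.range (avgPerformance δ n)).Nonempty := Set.range_nonempty _
  exact ⟨hne.csSup_mem hfin, fun a ha => le_csSup hfin.bddAbove ha⟩

end OneTrace

namespace OneTrace

open Finset

/-! ### Longest common subsequences and the insertion-deletion distance -/

/-! Upper bound: fix the deleted set `D`. The hypothesis is then a function of the bits outside `D`,
while the bits in `D` remain uniform and independent of it. Weigh a pair of strings by `(1 / 4) ^
indelDist`. Exposing the bits of `x` one at a time shows that against any fixed string each uniform
bit costs a factor `1/2 * 1 + 1/2 * 1/2 = 3/4`, since a head that disagrees forces an indel on one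
of two sides (`sum_prod_mul_indelWeight_le`). The mean weight is thus at most `(3 / 4) ^ #D`, and
convexity of `exp` turns this into an expected LCS loss linear in `#D` (`sum_lcsLength_trace_le`).
Averaging over `D`, with `#D` of mean `δ n`, finishes.

Lower bound: a hypothesis containing the trace shares a subsequence of length `n - #D` with `x`. -/

theorem exists_sublist_length_eq_lcsLength (u v : List Bool) :
    ∃ w : List Bool, w.Sublist u ∧ w.Sublist v ∧ w.length = lcsLength u v :=
  (lcsLength_isGreatest u v).1

theorem length_le_lcsLength {u v w : List Bool} (hu : w.Sublist u) (hv : w.Sublist v) :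
    w.length ≤ lcsLength u v :=
  (lcsLength_isGreatest u v).2 ⟨w, hu, hv, rfl⟩

theorem lcsLength_le_left (u v : List Bool) : lcsLength u v ≤ u.length := by
  obtain ⟨w, hu, -, hw⟩ := exists_sublist_length_eq_lcsLength u v
  exact hw ▸ hu.length_le

theorem lcsLength_le_right (u v : List Bool) : lcsLength u v ≤ v.length := by
  obtain ⟨w, -, hv, hw⟩ := exists_sublist_length_eq_lcsLength u v
  exact hw ▸ hv.length_le

theorem lcsLength_cons_cons_le (a b : Bool) (u v : List Bool) :
    lcsLength (a :: u) (b :: v) ≤ lcsLength u v + 1 := by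
  obtain ⟨w, hu, hv, hw⟩ := exists_sublist_length_eq_lcsLength (a :: u) (b :: v)
  have h := length_le_lcsLength (w := w.tail) (by simpa using hu.tail) (by simpa using hv.tail)
  rw [List.length_tail] at h
  omega

/-- Distinct heads cannot both be used by a common subsequence, so one of them can be dropped
without loss. -/
theorem lcsLength_cons_cons_le_of_ne {a b : Bool} (hab : a ≠ b) (u v : List Bool) :
    lcsLength (a :: u) (b :: v) ≤ lcsLength u (b :: v) ∨
      lcsLength (a :: u) (b :: v) ≤ lcsLength (a :: u) v := by
  obtain ⟨w, hu, hv, hw⟩ := exists_sublist_length_eq_lcsLength (a :: u) (b :: v)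
  rw [← hw]
  rcases List.sublist_cons_iff.1 hu with h | ⟨r, rfl, -⟩
  · exact .inl (length_le_lcsLength h hv)
  rcases List.sublist_cons_iff.1 hv with h | ⟨s, hs, -⟩
  · exact .inr (length_le_lcsLength hu h)
  · exact absurd (List.cons.inj hs).1 hab

/-- The least number of insertions and deletions that turn `u` into `v`. -/
noncomputable def indelDist (u v : List Bool) : ℕ :=
  u.length + v.length - 2 * lcsLength u v

theorem cast_indelDist (u v : List Bool) :
    (indelDist u v : ℝ) = u.length + v.length - 2 * lcsLength u v := by
  have h₁ := lcsLength_le_left u v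
  have h₂ := lcsLength_le_right u v
  rw [indelDist, Nat.cast_sub (by omega)]
  push_cast
  ring

theorem indelDist_nil_cons (a : Bool) (v : List Bool) :
    indelDist [] v + 1 ≤ indelDist [] (a :: v) := by
  have h := lcsLength_le_left [] (a :: v)
  simp only [indelDist, List.length_nil, List.length_cons] at h ⊢
  omega

theorem indelDist_le_cons_cons (a : Bool) (u v : List Bool) :
    indelDist u v ≤ indelDist (a :: u) (a :: v) := by
  have h := lcsLength_cons_cons_le a a u v
  simp only [indelDist, List.length_cons]
  omega

theorem indelDist_cons_cons_of_ne {a b : Bool} (hab : a ≠ b) (u v : List Bool) :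
    indelDist u (b :: v) + 1 ≤ indelDist (a :: u) (b :: v) ∨
      indelDist (a :: u) v + 1 ≤ indelDist (a :: u) (b :: v) := by
  have h₁ := lcsLength_le_left u (b :: v)
  have h₂ := lcsLength_le_right u (b :: v)
  have h₃ := lcsLength_le_left (a :: u) v
  have h₄ := lcsLength_le_right (a :: u) v
  have h := lcsLength_cons_cons_le_of_ne hab u v
  simp only [indelDist, List.length_cons] at h₁ h₂ h₃ h₄ ⊢
  omega

/-- An exponentially decaying weight in the insertion-deletion distance. -/
noncomputable def indelWeight (u v : List Bool) : ℝ :=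
  (1 / 4) ^ indelDist u v

theorem indelWeight_nonneg (u v : List Bool) : 0 ≤ indelWeight u v := by
  unfold indelWeight; positivity

theorem indelWeight_le_one (u v : List Bool) : indelWeight u v ≤ 1 :=
  pow_le_one₀ (by norm_num) (by norm_num)

theorem indelWeight_le_quarter_mul {u v u' v' : List Bool}
    (h : indelDist u' v' + 1 ≤ indelDist u v) :
    indelWeight u v ≤ 1 / 4 * indelWeight u' v' := by
  unfold indelWeight
  rw [← pow_succ']
  exact pow_le_pow_of_le_one (by norm_num) (by norm_num) h

theorem indelWeight_cons_cons_le (a : Bool) (u v : List Bool) :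
    indelWeight (a :: u) (a :: v) ≤ indelWeight u v :=
  pow_le_pow_of_le_one (by norm_num) (by norm_num) (indelDist_le_cons_cons a u v)

/-- Which head is dropped depends on the strings; bounding the maximum of the two cases by their sum
gives an inequality that can be averaged. -/
theorem indelWeight_cons_cons_le_of_ne {a b : Bool} (hab : a ≠ b) (u v : List Bool) :
    indelWeight (a :: u) (b :: v) ≤
      1 / 4 * indelWeight u (b :: v) + 1 / 4 * indelWeight (a :: u) v := by
  have h₁ := indelWeight_nonneg u (b :: v)
  have h₂ := indelWeight_nonneg (a :: u) v
  rcases indelDist_cons_cons_of_ne hab u v with h | h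
  · linarith [indelWeight_le_quarter_mul h]
  · linarith [indelWeight_le_quarter_mul h]

/-! ### The expected weight under product measures -/

section Fixed

variable {ι : Type*} [Fintype ι] {k : ι → ℝ} {g : ι → List Bool} {M : ℝ}

/-- The bound `M` is uniform in `z`, so it survives stripping equal heads. Unequal heads give at
most `M / 4 + M / 4`; one of these terms keeps `a` and shortens `z`, hence the induction on `z`. -/
theorem sum_indelWeight_cons_le (hk : ∀ i, 0 ≤ k i)
    (hM : ∀ z, ∑ i, k i * indelWeight z (g i) ≤ M) (a : Bool) (z : List Bool) :
    ∑ i, k i * indelWeight z (a :: g i) ≤ M := by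
  have hM0 : 0 ≤ M :=
    (sum_nonneg fun i _ => mul_nonneg (hk i) (indelWeight_nonneg [] (g i))).trans (hM [])
  induction z with
  | nil =>
    calc ∑ i, k i * indelWeight [] (a :: g i)
        ≤ ∑ i, 1 / 4 * (k i * indelWeight [] (g i)) := by
          refine sum_le_sum fun i _ => ?_
          nlinarith [mul_le_mul_of_nonneg_left
            (indelWeight_le_quarter_mul (indelDist_nil_cons a (g i))) (hk i)]
      _ ≤ M := by rw [← mul_sum]; linarith [hM []]
  | cons b z ih =>
    by_cases hba : b = a
    · subst hba
      exact (sum_le_sum fun i _ => mul_le_mul_of_nonneg_left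
        (indelWeight_cons_cons_le b z (g i)) (hk i)).trans (hM z)
    · calc ∑ i, k i * indelWeight (b :: z) (a :: g i)
          ≤ ∑ i, (1 / 4 * (k i * indelWeight z (a :: g i)) +
              1 / 4 * (k i * indelWeight (b :: z) (g i))) := by
            refine sum_le_sum fun i _ => ?_
            linarith [mul_le_mul_of_nonneg_left
              (indelWeight_cons_cons_le_of_ne hba z (g i)) (hk i)]
        _ ≤ M := by
            rw [sum_add_distrib, ← mul_sum, ← mul_sum]
            linarith [hM (b :: z)]

/-- The gain from a wrong head bit: two alternatives, each with a factor `1 / 4`. Any decay base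
below `1 / 2` would still gain here. -/
theorem sum_indelWeight_cons_not_le (hk : ∀ i, 0 ≤ k i)
    (hM : ∀ z, ∑ i, k i * indelWeight z (g i) ≤ M) (b : Bool) (z : List Bool) :
    ∑ i, k i * indelWeight (b :: z) ((!b) :: g i) ≤ 1 / 2 * M := by
  calc ∑ i, k i * indelWeight (b :: z) ((!b) :: g i)
      ≤ ∑ i, (1 / 4 * (k i * indelWeight z ((!b) :: g i)) +
          1 / 4 * (k i * indelWeight (b :: z) (g i))) := by
        have hb : b ≠ !b := by simp
        refine sum_le_sum fun i _ => ?_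
        linarith [mul_le_mul_of_nonneg_left
          (indelWeight_cons_cons_le_of_ne hb z (g i)) (hk i)]
    _ ≤ 1 / 2 * M := by
        rw [sum_add_distrib, ← mul_sum, ← mul_sum]
        linarith [hM (b :: z), sum_indelWeight_cons_le hk hM (!b) z]

theorem sum_indelWeight_nil_cons_le (hk : ∀ i, 0 ≤ k i)
    (hM : ∀ z, ∑ i, k i * indelWeight z (g i) ≤ M) (a : Bool) :
    ∑ i, k i * indelWeight [] (a :: g i) ≤ 1 / 4 * M := by
  calc ∑ i, k i * indelWeight [] (a :: g i)
      ≤ ∑ i, 1 / 4 * (k i * indelWeight [] (g i)) := by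
        refine sum_le_sum fun i _ => ?_
        linarith [mul_le_mul_of_nonneg_left
          (indelWeight_le_quarter_mul (indelDist_nil_cons a (g i))) (hk i)]
    _ ≤ 1 / 4 * M := by rw [← mul_sum]; linarith [hM []]

end Fixed

theorem sum_bool_cons {n : ℕ} (F : (Fin (n + 1) → Bool) → ℝ) (b : Bool) :
    ∑ x, F x = ∑ x : Fin n → Bool, F (Fin.cons b x) + ∑ x : Fin n → Bool, F (Fin.cons (!b) x) := by
  rw [← (Fin.consEquiv fun _ => Bool).sum_comp, Fintype.sum_prod_type, Fintype.sum_bool]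
  cases b
  · exact add_comm _ _
  · rfl

/-- If the bits of `x` are drawn from a product measure, then the expected weight of the distance
between `x` and any fixed string is at most a product of one factor for each bit. -/
theorem sum_prod_mul_indelWeight_le {n : ℕ} (k : Fin n → Bool → ℝ) (B : Fin n → ℝ)
    (hk : ∀ i b, 0 ≤ k i b) (hB : ∀ i b, k i b + 1 / 2 * k i (!b) ≤ B i) (z : List Bool) :
    ∑ x : Fin n → Bool, (∏ i, k i (x i)) * indelWeight z (List.ofFn x) ≤ ∏ i, B i := by
  induction n generalizing z with
  | zero => simpa using indelWeight_le_one z []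
  | succ n ih =>
    have hM := fun z => ih (fun i => k i.succ) (fun i => B i.succ) (fun i => hk i.succ)
      (fun i => hB i.succ) z
    set M := ∏ i : Fin n, B i.succ
    have hK : ∀ x : Fin n → Bool, 0 ≤ ∏ i, k i.succ (x i) := fun x =>
      prod_nonneg fun i _ => hk _ _
    have hM0 : 0 ≤ M := prod_nonneg fun i _ => by
      linarith [hB i.succ true, hk i.succ true, hk i.succ (!true)]
    have expand : ∀ b, ∑ x, (∏ i, k i (x i)) * indelWeight z (List.ofFn x) =
        k 0 b * ∑ x : Fin n → Bool, (∏ i, k i.succ (x i)) * indelWeight z (b :: List.ofFn x) +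
        k 0 (!b) *
          ∑ x : Fin n → Bool, (∏ i, k i.succ (x i)) * indelWeight z ((!b) :: List.ofFn x) := by
      intro b
      rw [sum_bool_cons _ b]
      simp only [Fin.prod_univ_succ, Fin.cons_zero, Fin.cons_succ, List.ofFn_succ, mul_sum,
        mul_assoc]
    rw [Fin.prod_univ_succ]
    cases z with
    -- Against the empty string either head bit costs a factor `1 / 4`, well within `B 0`.
    | nil =>
      rw [expand true]
      have h₁ := sum_indelWeight_nil_cons_le hK hM true
      have h₂ := sum_indelWeight_nil_cons_le hK hM (!true)
      have h₃ := mul_le_mul_of_nonneg_left h₁ (hk 0 true)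
      have h₄ := mul_le_mul_of_nonneg_left h₂ (hk 0 (!true))
      have h₅ := mul_le_mul_of_nonneg_right (hB 0 true) hM0
      have h₆ := mul_nonneg (hk 0 true) hM0
      have h₇ := mul_nonneg (hk 0 (!true)) hM0
      linarith
    | cons b z =>
      rw [expand b]
      have h₁ := sum_indelWeight_cons_le hK hM b (b :: z)
      have h₂ := sum_indelWeight_cons_not_le hK hM b z
      have h₃ := mul_le_mul_of_nonneg_left h₁ (hk 0 b)
      have h₄ := mul_le_mul_of_nonneg_left h₂ (hk 0 (!b))
      have h₅ := mul_le_mul_of_nonneg_right (hB 0 b) hM0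
      linarith

/-! ### Deletions at known locations -/

/-- The probability of reaching `x'` from `x` by resampling the bits of `x` at the locations
in `D`. -/
noncomputable def resampleProb {n : ℕ} (D : Finset (Fin n)) (x x' : Fin n → Bool) : ℝ :=
  ∏ i, if i ∈ D then 1 / 2 else if x' i = x i then 1 else 0

theorem resampleProb_comm {n : ℕ} (D : Finset (Fin n)) (x x' : Fin n → Bool) :
    resampleProb D x x' = resampleProb D x' x := by
  simp only [resampleProb, eq_comm]

theorem sum_resampleProb {n : ℕ} (D : Finset (Fin n)) (x : Fin n → Bool) :
    ∑ x', resampleProb D x x' = 1 := by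
  unfold resampleProb
  rw [← Fintype.prod_sum fun i b => if i ∈ D then (1 / 2 : ℝ) else if b = x i then 1 else 0]
  refine prod_eq_one fun i _ => ?_
  by_cases hi : i ∈ D
  · simp [hi]
  · simp [hi]

theorem eq_of_resampleProb_ne_zero {n : ℕ} {D : Finset (Fin n)} {x x' : Fin n → Bool}
    (h : resampleProb D x x' ≠ 0) {i : Fin n} (hi : i ∉ D) : x' i = x i := by
  by_contra hne
  exact h (prod_eq_zero (mem_univ i) (by simp [hi, hne]))

theorem trace_congr {n : ℕ} {D : Finset (Fin n)} {x x' : Fin n → Bool}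
    (h : ∀ i, i ∉ D → x' i = x i) : trace x' D = trace x D :=
  List.map_congr_left fun i hi => h i (by simpa using (List.mem_filter.1 hi).2)

theorem sum_indelWeight_trace_le {n : ℕ} (D : Finset (Fin n)) (f : List Bool → List Bool) :
    ∑ x : Fin n → Bool, indelWeight (f (trace x D)) (List.ofFn x) ≤ 2 ^ n * (3 / 4) ^ #D := by
  calc ∑ x : Fin n → Bool, indelWeight (f (trace x D)) (List.ofFn x)
      = ∑ x : Fin n → Bool, ∑ x' : Fin n → Bool,
          resampleProb D x x' * indelWeight (f (trace x D)) (List.ofFn x) := by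
        simp_rw [← sum_mul, sum_resampleProb, one_mul]
    _ = ∑ x' : Fin n → Bool, ∑ x : Fin n → Bool,
          resampleProb D x' x * indelWeight (f (trace x' D)) (List.ofFn x) := by
        -- The kernel is symmetric and preserves the trace, so the roles of `x` and `x'` can be
        -- exchanged: the hypothesis is now fixed by `x'`, and `x` has a product law given `x'`.
        rw [sum_comm]
        refine sum_congr rfl fun x' _ => sum_congr rfl fun x _ => ?_
        rw [resampleProb_comm]
        by_cases h : resampleProb D x' x = 0
        · simp [h]
        · rw [trace_congr fun i hi => eq_of_resampleProb_ne_zero h hi]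
    _ ≤ ∑ _x' : Fin n → Bool, (3 / 4) ^ #D := by
        refine sum_le_sum fun x' _ => ?_
        have hprod : ∏ i, (if i ∈ D then (3 / 4 : ℝ) else 1) = (3 / 4) ^ #D := by
          rw [prod_ite_mem, univ_inter, prod_const]
        rw [← hprod]
        refine sum_prod_mul_indelWeight_le
          (fun i b => if i ∈ D then 1 / 2 else if b = x' i then 1 else 0) _ ?_ ?_ _
        · intro i b
          split_ifs <;> norm_num
        · intro i b
          by_cases hi : i ∈ D
          · simp only [hi, if_true]
            norm_num
          · cases b <;> cases x' i <;> norm_num [hi]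
    _ = 2 ^ n * (3 / 4) ^ #D := by simp

/-- The rate at which the performance of any one-trace algorithm decays with the number of
deletions. -/
noncomputable def lossRate : ℝ :=
  Real.log (4 / 3) / (2 * Real.log 4)

theorem lossRate_pos : 0 < lossRate :=
  div_pos (Real.log_pos (by norm_num)) (mul_pos two_pos (Real.log_pos (by norm_num)))

theorem sum_lcsLength_trace_le {n : ℕ} (D : Finset (Fin n)) (A : List Bool → (Fin n → Bool)) :
    ∑ x : Fin n → Bool, (lcsLength (List.ofFn (A (trace x D))) (List.ofFn x) : ℝ) ≤
      2 ^ n * (n - lossRate * #D) := by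
  have hlog : 0 < Real.log 4 := Real.log_pos (by norm_num)
  have hrate : 2 * Real.log 4 * lossRate = Real.log (4 / 3) := by
    unfold lossRate
    field_simp
  -- Tangent line `1 + t ≤ exp t`, playing the role of Jensen's inequality. Both strings have length
  -- `n`, so the right side is exactly `exp t`; `lossRate` is chosen to make this so.
  have hpoint : ∀ x : Fin n → Bool,
      1 + 2 * Real.log 4 * ((lcsLength (List.ofFn (A (trace x D))) (List.ofFn x) : ℝ) -
          (n - lossRate * #D)) ≤
        (4 / 3) ^ #D * indelWeight (List.ofFn (A (trace x D))) (List.ofFn x) := by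
    intro x
    have hexp : (4 / 3 : ℝ) ^ #D * indelWeight (List.ofFn (A (trace x D))) (List.ofFn x) =
        Real.exp (#D * Real.log (4 / 3) -
          indelDist (List.ofFn (A (trace x D))) (List.ofFn x) * Real.log 4) := by
      rw [Real.exp_sub, Real.exp_nat_mul, Real.exp_nat_mul, Real.exp_log (by norm_num),
        Real.exp_log (by norm_num), indelWeight, one_div, inv_pow, div_eq_mul_inv (_ ^ #D)]
    rw [hexp, cast_indelDist, ← hrate]
    simp only [List.length_ofFn]
    refine le_trans (le_of_eq ?_) (Real.add_one_le_exp _)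
    ring
  have hsum := (sum_le_sum fun x (_ : x ∈ univ) => hpoint x).trans_eq
    (mul_sum _ _ _).symm
  have hW := mul_le_mul_of_nonneg_left
    (sum_indelWeight_trace_le D fun y => List.ofFn (A y)) (by positivity : (0 : ℝ) ≤ (4 / 3) ^ #D)
  have hone : (4 / 3 : ℝ) ^ #D * (2 ^ n * (3 / 4) ^ #D) = 2 ^ n := by
    rw [mul_left_comm, ← mul_pow]
    norm_num
  -- After summation the constant terms `2 ^ n` on the two sides cancel, leaving a nonpositive total
  -- deviation.
  have h := hsum.trans (hW.trans_eq hone)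
  rw [sum_add_distrib, ← mul_sum, sum_sub_distrib] at h
  simp only [sum_const, card_univ, Fintype.card_pi, Fintype.card_bool, prod_const,
    Fintype.card_fin, nsmul_eq_mul, mul_one, Nat.cast_pow, Nat.cast_ofNat] at h
  exact sub_nonpos.1 (nonpos_of_mul_nonpos_right (by linarith) (mul_pos two_pos hlog))

/-! ### Averaging over the deleted locations -/

theorem sum_prod_ite_mem {n : ℕ} (f g : Fin n → ℝ) :
    ∑ D : Finset (Fin n), ∏ i, (if i ∈ D then f i else g i) = ∏ i, (f i + g i) := by
  rw [Fintype.prod_add]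
  refine sum_congr rfl fun D _ => ?_
  rw [prod_ite]
  congr 2 <;> ext <;> simp

theorem deletionProb_nonneg {δ : ℝ} (h₀ : 0 ≤ δ) (h₁ : δ ≤ 1) {n : ℕ} (D : Finset (Fin n)) :
    0 ≤ deletionProb δ D :=
  prod_nonneg fun i _ => by split_ifs <;> linarith

theorem sum_deletionProb (δ : ℝ) (n : ℕ) : ∑ D : Finset (Fin n), deletionProb δ D = 1 := by
  simp [deletionProb, sum_prod_ite_mem]

theorem sum_deletionProb_mul_mem (δ : ℝ) {n : ℕ} (j : Fin n) :
    ∑ D : Finset (Fin n), deletionProb δ D * (if j ∈ D then 1 else 0) = δ := by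
  -- Absorbing the indicator into the product makes factor `j` contribute `δ + 0` and every other
  -- factor `δ + (1 - δ) = 1`.
  have h : ∀ D : Finset (Fin n), deletionProb δ D * (if j ∈ D then 1 else 0) =
      ∏ i, if i ∈ D then δ else if i = j then 0 else 1 - δ := by
    intro D
    by_cases hj : j ∈ D
    · rw [if_pos hj, mul_one, deletionProb]
      refine prod_congr rfl fun i _ => ?_
      by_cases hi : i ∈ D
      · simp [hi]
      · simp [hi, show i ≠ j from fun h => hi (h ▸ hj)]
    · rw [if_neg hj, mul_zero, prod_eq_zero (mem_univ j) (by simp [hj])]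
  simp_rw [h]
  rw [sum_prod_ite_mem, prod_eq_single j]
  · simp
  · intro i _ hi
    simp [hi]
  · simp

/-- The expected number of deletions is `δ n`. -/
theorem sum_deletionProb_mul_card (δ : ℝ) (n : ℕ) :
    ∑ D : Finset (Fin n), deletionProb δ D * #D = δ * n := by
  have h : ∀ D : Finset (Fin n), (#D : ℝ) = ∑ j, if j ∈ D then 1 else 0 := fun D => by simp
  simp_rw [h, mul_sum]
  rw [sum_comm]
  simp_rw [sum_deletionProb_mul_mem]
  simp [mul_comm]

/-- Serves both bounds: `c = lossRate` for the upper one and `c = 1` for padding. -/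
theorem sum_deletionProb_mul_affine (δ c : ℝ) (n : ℕ) :
    ∑ D : Finset (Fin n), deletionProb δ D * (n - c * #D) = (1 - c * δ) * n := by
  simp_rw [mul_sub, mul_left_comm _ c]
  rw [sum_sub_distrib, ← sum_mul, ← mul_sum, sum_deletionProb, sum_deletionProb_mul_card]
  ring

theorem avgPerformance_eq (δ : ℝ) (n : ℕ) (A : List Bool → (Fin n → Bool)) :
    avgPerformance δ n A = (∑ D : Finset (Fin n), deletionProb δ D *
      ∑ x : Fin n → Bool, (lcsLength (List.ofFn (A (trace x D))) (List.ofFn x) : ℝ)) / 2 ^ n := by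
  simp only [avgPerformance, traceExpectation, mul_sum]
  rw [sum_comm]

theorem avgPerformance_le {δ : ℝ} (h₀ : 0 ≤ δ) (h₁ : δ ≤ 1) (n : ℕ)
    (A : List Bool → (Fin n → Bool)) :
    avgPerformance δ n A ≤ (1 - lossRate * δ) * n := by
  rw [avgPerformance_eq, div_le_iff₀ (by positivity), ← sum_deletionProb_mul_affine, sum_mul]
  refine sum_le_sum fun D _ => ?_
  rw [mul_assoc, mul_comm _ ((2 : ℝ) ^ n)]
  exact mul_le_mul_of_nonneg_left (sum_lcsLength_trace_le D A) (deletionProb_nonneg h₀ h₁ D)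

/-! ### Padding the trace -/

/-- The algorithm that pads the trace with zeros. -/
def padTrace (n : ℕ) (y : List Bool) : Fin n → Bool :=
  fun i => y.getD i false

theorem sublist_ofFn_padTrace {n : ℕ} {y : List Bool} (hy : y.length ≤ n) :
    y.Sublist (List.ofFn (padTrace n y)) := by
  have h : (List.ofFn (padTrace n y)).take y.length = y := by
    refine List.ext_getElem (by simpa using hy) fun i h₁ h₂ => ?_
    simp [padTrace, h₂]
  have hsub := List.take_sublist y.length (List.ofFn (padTrace n y))
  rwa [h] at hsub

theorem trace_sublist {n : ℕ} (x : Fin n → Bool) (D : Finset (Fin n)) :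
    (trace x D).Sublist (List.ofFn x) := by
  rw [List.ofFn_eq_map]
  exact List.filter_sublist.map x

theorem length_trace {n : ℕ} (x : Fin n → Bool) (D : Finset (Fin n)) :
    ((trace x D).length : ℝ) = n - #D := by
  have h : (trace x D).length = #Dᶜ := by
    rw [trace, List.length_map, ← List.toFinset_card_of_nodup ((List.nodup_finRange n).filter _)]
    congr 1
    ext
    simp
  rw [h, card_compl, Fintype.card_fin, Nat.cast_sub (by simpa using card_le_univ D)]

theorem le_avgPerformance_padTrace {δ : ℝ} (h₀ : 0 ≤ δ) (h₁ : δ ≤ 1) (n : ℕ) :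
    (1 - δ) * n ≤ avgPerformance δ n (padTrace n) := by
  have h := sum_deletionProb_mul_affine δ 1 n
  simp only [one_mul] at h
  rw [avgPerformance_eq, le_div_iff₀ (by positivity), ← h, sum_mul]
  refine sum_le_sum fun D _ => ?_
  rw [mul_assoc]
  refine mul_le_mul_of_nonneg_left ?_ (deletionProb_nonneg h₀ h₁ D)
  calc ((n : ℝ) - #D) * 2 ^ n = ∑ _x : Fin n → Bool, ((n : ℝ) - #D) := by
        simp only [sum_const, card_univ, Fintype.card_pi, Fintype.card_bool, prod_const,
          Fintype.card_fin, nsmul_eq_mul, Nat.cast_pow, Nat.cast_ofNat, mul_comm]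
    _ ≤ _ := by
      refine sum_le_sum fun x _ => ?_
      rw [← length_trace x D]
      refine Nat.cast_le.2 (length_le_lcsLength (sublist_ofFn_padTrace ?_) (trace_sublist x D))
      simpa using (trace_sublist x D).length_le

end OneTrace

theorem mainTheorem5 :
    (∃ c : ℝ, 0 < c ∧
      ∀ δ : ℕ → ℝ, (∀ n, 0 < δ n ∧ δ n < 1) →
        Asymptotics.IsLittleO Filter.atTop (fun n : ℕ => (1 : ℝ) / (n : ℝ)) δ →
        ∀ᶠ n : ℕ in Filter.atTop,
          OneTrace.bestAvgPerformance (δ n) n ≤ (1 - c * δ n) * (n : ℝ)) ∧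
    (∀ (δ : ℝ) (n : ℕ), 0 < δ → δ < 1 →
      (1 - δ) * (n : ℝ) ≤ OneTrace.bestAvgPerformance δ n) := by
  refine ⟨⟨OneTrace.lossRate, OneTrace.lossRate_pos, fun δ hδ _ => .of_forall fun n => ?_⟩,
    fun δ n h₀ h₁ => ?_⟩
  · exact ciSup_le fun A => OneTrace.avgPerformance_le (hδ n).1.le (hδ n).2.le n A
  · exact (OneTrace.le_avgPerformance_padTrace h₀.le h₁.le n).trans
      ((OneTrace.bestAvgPerformance_isGreatest δ n).2 ⟨_, rfl⟩)
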